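/- Let $\Omega\subset\mathbb R^n$, $D\subset\mathbb R^m$ be open (for instance domains), let $\|\cdot\|$ be the Euclidean norm, and let $f:\Omega\times D\to\mathbb R^n$ be real analytic. Let $D_1\subset D$ be open, assume $f(\Omega\times D_1)\subset\Omega$, and write $f^k(\cdot,\alpha)$ for the $k$-th iterate of $f(\cdot,\alpha):\Omega\to\Omega$. Let $\varphi:D_1\to\Omega$ be an analytic path of asymptotically stable steady states: $\varphi$ is real analytic and, for every $\alpha\in D_1$, $f(\varphi(\alpha),\alpha)=\varphi(\alpha)$; for every $\varepsilon>0$ there is $\delta>0$ such that $x\in\Omega$, $\|x-\varphi(\alpha)\|<\delta$ imply $\|f^k(x,\alpha)-\varphi(\alpha)\|<\varepsilon$ for all $k\ge 0$; and there is $r>0$ such that $f^k(x,\alpha)\to\varphi(\alpha)$ as $k\to\infty$ for all $x\in\Omega$ with $\|x-\varphi(\alpha)\|<r$. Assume moreover that $\|\partial_x f(\varphi(\alpha),\alpha)\|<1$ (operator norm) for every $\alpha\in D_1$. For $\alpha\in D_1$ let $$DA(\varphi(\alpha))=\{x\in\Omega : f^k(x,\alpha)\to\varphi(\alpha)\text{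 as }k\to\infty\},$$ $$G=\bigcup_{\alpha\in D_1}DA(\varphi(\alpha))\times\{\alpha\},\qquad V(x,\alpha)=\sum_{k=0}^\infty\|f^k(x,\alpha)-\varphi(\alpha)\|^2 .$$ Then $G$ is an open subset of $\Omega\times D$, the series converges at every point of $G$, $V$ is non-negative and real analytic on $G$, and: a. $(\varphi(\alpha),\alpha)\in G$ for every $\alpha\in D_1$. b. For every $(x,\alpha)\in G$ one has $(f(x,\alpha),\alpha)\in G$ and $V(f(x,\alpha),\alpha)-V(x,\alpha)=-\|x-\varphi(\alpha)\|^2$; and $V(\varphi(\alpha),\alpha)=0$ for every $\alpha\in D_1$. c. For every $\alpha\in D_1$, $DA(\varphi(\alpha))$ is the natural domain of analyticity in $\Omega$ of $V(\cdot,\alpha)$: it is open, $V(\cdot,\alpha)$ is real analytic on it, and whenever $U_2\subset\Omega$ is open and connected, $v$ is real analytic on $U_2$, and $v=V(\cdot,\alpha)$ on some non-empty open set $U_1\subset U_2\cap DA(\varphi(\alpha))$, then $U_2\subset DA(\varphi(\alpha))$. d. For every $\alpha\in D_1$ and every point $x^0\in\Omega$ of the boundary of $DA(\varphi(\alpha))$,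 $V(x,\alpha)\to+\infty$ as $x\to x^0$, $x\in DA(\varphi(\alpha))$. -/

import Mathlib

open Set Filter Topology

namespace ControlSystem

/-- State space (and parameter space): real coordinate space with the Euclidean norm. -/
abbrev E (n : ℕ) : Type := EuclideanSpace ℝ (Fin n)

/-- The `k`-th iterate `f^k(x, α)` of `x ↦ f (x, α)` with the control parameter `α` frozen. -/
def iter {n m : ℕ} (f : E n × E m → E n) (α : E m) (k : ℕ) (x : E n) : E n :=
  (fun y => f (y, α))^[k] x

/-- `x₀ ∈ Ω` is a steady state for the control parameter `α`. -/
def IsSteadyState {n m : ℕ} (Ω : Set (E n)) (f : E n × E m → E n) (α : E m) (x₀ : E n) : Prop :=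
  x₀ ∈ Ω ∧ f (x₀, α) = x₀

/-- Stability; the balls are balls of `Ω`. -/
def IsStable {n m : ℕ} (Ω : Set (E n)) (f : E n × E m → E n) (α : E m) (x₀ : E n) : Prop :=
  ∀ ε > 0, ∃ δ > 0, ∀ x ∈ Ω ∩ Metric.ball x₀ δ, ∀ k : ℕ, iter f α k x ∈ Ω ∩ Metric.ball x₀ ε

/-- Asymptotic stability of a steady state. -/
def IsAsymptoticallyStable {n m : ℕ} (Ω : Set (E n)) (f : E n × E m → E n) (α : E m)
    (x₀ : E n) : Prop :=
  IsSteadyState Ω f α x₀ ∧ IsStable Ω f α x₀ ∧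
    ∃ r > 0, ∀ x ∈ Ω ∩ Metric.ball x₀ r, Tendsto (fun k : ℕ => iter f α k x) atTop (𝓝 x₀)

/-- The domain of attraction `DA(x₀)` for the control parameter `α`. -/
def DA {n m : ℕ} (Ω : Set (E n)) (f : E n × E m → E n) (α : E m) (x₀ : E n) : Set (E n) :=
  {x | x ∈ Ω ∧ Tendsto (fun k : ℕ => iter f α k x) atTop (𝓝 x₀)}

/-- `φ` is an analytic path, defined on `D₁`, of asymptotically stable steady states. -/
def IsStablePath {n m : ℕ} (Ω : Set (E n)) (D₁ : Set (E m)) (f : E n × E m → E n)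
    (φ : E m → E n) : Prop :=
  AnalyticOnNhd ℝ φ D₁ ∧ ∀ α ∈ D₁, IsAsymptoticallyStable Ω f α (φ α)

/-- The union over `α ∈ D₁` of the sets `DA(φ(α)) × {α}`. -/
def G {n m : ℕ} (Ω : Set (E n)) (D₁ : Set (E m)) (f : E n × E m → E n) (φ : E m → E n) :
    Set (E n × E m) :=
  ⋃ α ∈ D₁, DA Ω f α (φ α) ×ˢ {α}

/-- The function `V(x, α) = ∑ₖ ‖f^k(x, α) - φ(α)‖²`. -/
noncomputable def V {n m : ℕ} (f : E n × E m → E n) (φ : E m → E n) (p : E n × E m) : ℝ :=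
  ∑' k : ℕ, ‖iter f p.2 k p.1 - φ p.2‖ ^ 2

/-- `U` is the natural domain of analyticity, inside the ambient open set `Ω`, of the real function
`u` (only the values of `u` on `U` matter): `u` is analytic on the open set `U ⊆ Ω`, and no
restriction of `u` to a nonempty open subset `U₁` of `U` continues analytically to a connected open
subset `U₂` of `Ω` that contains `U₁` and is not contained in `U`. -/
def IsNaturalDomain {n : ℕ} (Ω U : Set (E n)) (u : E n → ℝ) : Prop :=
  IsOpen U ∧ U ⊆ Ω ∧ AnalyticOnNhd ℝ u U ∧
    ∀ (U₁ U₂ : Set (E n)) (v : E n → ℝ), IsOpen U₁ → U₁.Nonempty → U₁ ⊆ U₂ ∩ U →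
      IsOpen U₂ → IsConnected U₂ → U₂ ⊆ Ω → AnalyticOnNhd ℝ v U₂ → EqOn v u U₁ → U₂ ⊆ U

end ControlSystem

/-! The heart is joint analyticity of `V` at a point `(φ α₀, α₀)`; locally uniform convergence of
real analytic functions would not give it. Choose `c` with `‖∂ₓf(φ α₀, α₀)‖ < c < 1`. Near that
point orbits contract at rate `c`, so the rescaled orbit `uₖ = c⁻ᵏ(fᵏ(x, α) - φ α)` is a bounded
sequence. It solves one equation in the space of bounded sequences: `u` minus a shift of the
superposition operator of `f` at `u` equals `(x - φ α, 0, 0, …)`. The operator is analytic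
(`exists_analytic_superposition`) and the linearization is the identity minus a map of norm below
one, so the inverse function theorem (`exists_analytic_leftInverse`) makes `u` analytic in `(x, α)`.
Since `V = ∑ c²ᵏ‖uₖ‖²` is a continuous quadratic form in `u`, `analyticAt_V_of_contracting` follows.

Every orbit in `G` eventually enters such a neighbourhood, and `V` is a finite sum of analytic terms
plus `V` after `k` steps, so openness, summability and analyticity spread to all of `G`.

The orbit of a point of `Ω` outside the domain of attraction never enters a fixed ball about the
steady state. Hence its partial sums are unbounded, and by continuity `V` blows up at the boundary
(`tendsto_V_frontier`). An analytic continuation across the boundary would have to stay finite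
there. -/

namespace ControlSystem

open scoped BoundedContinuousFunction

/-! ### Analyticity of the superposition operator on bounded sequences. -/

section Superposition

variable {Z F : Type*} [NormedAddCommGroup Z] [NormedSpace ℝ Z]
  [NormedAddCommGroup F] [NormedSpace ℝ F]

/-- A uniformly bounded sequence of continuous multilinear maps, seen as one continuous multilinear
map with values in bounded sequences. -/
noncomputable def multilinearOfSeq {X : Type*} [NormedAddCommGroup X] [NormedSpace ℝ X] {j : ℕ}
    (q : ℕ → ContinuousMultilinearMap ℝ (fun _ : Fin j => X) F) (C : ℝ)
    (hq : ∀ k v, ‖q k v‖ ≤ C * ∏ i, ‖v i‖) :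
    ContinuousMultilinearMap ℝ (fun _ : Fin j => X) (ℕ →ᵇ F) :=
  MultilinearMap.mkContinuous
    { toFun := fun v => BoundedContinuousFunction.ofNormedAddCommGroupDiscrete (fun k => q k v)
        (C * ∏ i, ‖v i‖) fun k => hq k v
      map_update_add' := by
        intro _ v i x y
        ext k
        simp
      map_update_smul' := by
        intro _ v i a x
        ext k
        simp }
    -- `C` may be negative here, whereas a sup-norm bound must be nonnegative.
    (max C 0) fun v => by
      have hp : 0 ≤ ∏ i, ‖v i‖ := Finset.prod_nonneg fun i _ => norm_nonneg _
      refine (BoundedContinuousFunction.norm_le (by positivity)).2 fun k => ?_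
      exact (hq k v).trans (by gcongr; exact le_max_left _ _)

theorem norm_multilinearOfSeq_le {X : Type*} [NormedAddCommGroup X] [NormedSpace ℝ X] {j : ℕ}
    (q : ℕ → ContinuousMultilinearMap ℝ (fun _ : Fin j => X) F) {C : ℝ} (hC : 0 ≤ C)
    (hq : ∀ k v, ‖q k v‖ ≤ C * ∏ i, ‖v i‖) : ‖multilinearOfSeq q C hq‖ ≤ C := by
  refine ContinuousMultilinearMap.opNorm_le_bound hC fun v => ?_
  have hp : 0 ≤ ∏ i, ‖v i‖ := Finset.prod_nonneg fun i _ => norm_nonneg _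
  exact (BoundedContinuousFunction.norm_le (by positivity)).2 fun k => hq k v

/-- The rescaled increment `v ↦ t⁻¹ (p (b + t sₖ) - p b)` of a continuous multilinear map,
where `v = (s, b)`. -/
noncomputable def incrementMap {j : ℕ} (p : ContinuousMultilinearMap ℝ (fun _ : Fin j => Z) F)
    (t : ℝ) (k : ℕ) : ContinuousMultilinearMap ℝ (fun _ : Fin j => (ℕ →ᵇ Z) × Z) F :=
  t⁻¹ • (p.compContinuousLinearMap (fun _ => ContinuousLinearMap.snd ℝ (ℕ →ᵇ Z) Z +
      t • (BoundedContinuousFunction.evalCLM ℝ k).comp (ContinuousLinearMap.fst ℝ (ℕ →ᵇ Z) Z)) -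
    p.compContinuousLinearMap (fun _ => ContinuousLinearMap.snd ℝ (ℕ →ᵇ Z) Z))

theorem incrementMap_apply {j : ℕ} (p : ContinuousMultilinearMap ℝ (fun _ : Fin j => Z) F)
    (t : ℝ) (k : ℕ) (v : Fin j → (ℕ →ᵇ Z) × Z) :
    incrementMap p t k v =
      t⁻¹ • (p (fun i => (v i).2 + t • (v i).1 k) - p (fun i => (v i).2)) := rfl

/-- Telescoping the difference slot by slot leaves a factor `t` in each of the `j` terms, which
cancels `t⁻¹`. The bound is therefore uniform in `t` and `k`. One `2 ^ j` comes from `‖b + t s‖ ≤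
2‖v‖`, the other absorbs the number of terms. -/
theorem norm_incrementMap_apply_le {j : ℕ}
    (p : ContinuousMultilinearMap ℝ (fun _ : Fin j => Z) F) {t : ℝ} (ht : 0 < t) (ht1 : t ≤ 1)
    (k : ℕ) (v : Fin j → (ℕ →ᵇ Z) × Z) :
    ‖incrementMap p t k v‖ ≤ 4 ^ j * ‖p‖ * ∏ i, ‖v i‖ := by
  have hs : ∀ i, ‖(v i).1 k‖ ≤ ‖v i‖ := fun i =>
    ((v i).1.norm_coe_le_norm k).trans (norm_fst_le _)
  have hb : ∀ i, ‖(v i).2‖ ≤ ‖v i‖ := fun i => norm_snd_le _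
  have hbs : ∀ i, ‖(v i).2 + t • (v i).1 k‖ ≤ 2 * ‖v i‖ := fun i => by
    refine (norm_add_le _ _).trans ?_
    rw [norm_smul, Real.norm_of_nonneg ht.le]
    nlinarith [hs i, hb i, norm_nonneg ((v i).1 k)]
  have key : ‖p (fun i => (v i).2 + t • (v i).1 k) - p (fun i => (v i).2)‖ ≤
      ‖p‖ * ∑ _i : Fin j, t * ∏ l, (2 * ‖v l‖) := by
    refine (p.norm_image_sub_le' _ _).trans ?_
    gcongr with i
    calc _ ≤ ∏ l, (if l = i then t else 1) * (2 * ‖v l‖) := by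
          refine Finset.prod_le_prod (fun l _ => by split_ifs <;> positivity) fun l _ => ?_
          split_ifs with h
          · subst h
            rw [add_sub_cancel_left, norm_smul, Real.norm_of_nonneg ht.le]
            gcongr
            linarith [hs l, norm_nonneg (v l)]
          · rw [one_mul]
            exact max_le (hbs l) (by linarith [hb l, norm_nonneg (v l)])
      _ = t * ∏ l, (2 * ‖v l‖) := by
          rw [Finset.prod_mul_distrib, Finset.prod_ite_eq' Finset.univ i (fun _ => t)]
          simp
  have hp : 0 ≤ ∏ i, ‖v i‖ := Finset.prod_nonneg fun i _ => norm_nonneg _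
  have hj : (j : ℝ) ≤ 2 ^ j := by exact_mod_cast Nat.lt_two_pow_self.le
  rw [incrementMap_apply, norm_smul, norm_inv, Real.norm_of_nonneg ht.le]
  calc t⁻¹ * _ ≤ t⁻¹ * (‖p‖ * ∑ _i : Fin j, t * ∏ l, (2 * ‖v l‖)) := by gcongr
    _ = (j * 2 ^ j) * ‖p‖ * ∏ i, ‖v i‖ := by
        simp only [Finset.sum_const, Finset.card_univ, Fintype.card_fin, nsmul_eq_mul,
          Finset.prod_mul_distrib, Finset.prod_const]
        field_simp
    _ ≤ (2 ^ j * 2 ^ j) * ‖p‖ * ∏ i, ‖v i‖ := by gcongr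
    _ = 4 ^ j * ‖p‖ * ∏ i, ‖v i‖ := by rw [← mul_pow]; norm_num

/-- The power series of the weighted superposition operator. -/
noncomputable def superpositionSeries (p : FormalMultilinearSeries ℝ Z F) {c : ℝ} (hc : 0 < c)
    (hc1 : c ≤ 1) : FormalMultilinearSeries ℝ ((ℕ →ᵇ Z) × Z) (ℕ →ᵇ F) := fun j =>
  multilinearOfSeq (fun k => incrementMap (p j) (c ^ k) k) (4 ^ j * ‖p j‖) fun k v =>
    norm_incrementMap_apply_le (p j) (pow_pos hc k) (pow_le_one₀ hc.le hc1) k v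

theorem superpositionSeries_apply (p : FormalMultilinearSeries ℝ Z F) {c : ℝ} (hc : 0 < c)
    (hc1 : c ≤ 1) (j : ℕ) (v : Fin j → (ℕ →ᵇ Z) × Z) (k : ℕ) :
    superpositionSeries p hc hc1 j v k =
      (c ^ k)⁻¹ • (p j (fun i => (v i).2 + c ^ k • (v i).1 k) - p j (fun i => (v i).2)) := rfl

/-- The factor `4 ^ j` in the coefficient bound only divides the radius by four. -/
theorem superpositionSeries_radius_pos {p : FormalMultilinearSeries ℝ Z F} (hp : 0 < p.radius)
    {c : ℝ} (hc : 0 < c) (hc1 : c ≤ 1) : 0 < (superpositionSeries p hc hc1).radius := by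
  obtain ⟨r, hr0, hr⟩ := ENNReal.lt_iff_exists_nnreal_btwn.1 hp
  obtain ⟨C, -, hC⟩ := p.norm_mul_pow_le_of_lt_radius hr
  have hr4 : 0 < r / 4 := by
    have : 0 < r := by exact_mod_cast hr0
    positivity
  refine lt_of_lt_of_le (by exact_mod_cast hr4)
    ((superpositionSeries p hc hc1).le_radius_of_bound C (r := r / 4) fun j => ?_)
  calc _ ≤ (4 ^ j * ‖p j‖) * ((r / 4 : NNReal) : ℝ) ^ j := by
        gcongr
        exact norm_multilinearOfSeq_le _ (by positivity) _
    _ = ‖p j‖ * (r : ℝ) ^ j := by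
        push_cast
        rw [div_pow]
        field_simp
    _ ≤ C := hC j

/-- For `f` analytic at `b₀`, the weighted increments `c⁻ᵏ (f (b + cᵏ sₖ) - f b)` form a bounded
sequence depending analytically on the bounded sequence `s` near `0` and on `b` near `b₀`. -/
theorem exists_analytic_superposition [CompleteSpace F] {f : Z → F} {b₀ : Z}
    (hf : AnalyticAt ℝ f b₀) {c : ℝ} (hc : 0 < c) (hc1 : c ≤ 1) :
    ∃ N : (ℕ →ᵇ Z) × Z → (ℕ →ᵇ F), AnalyticAt ℝ N (0, b₀) ∧
      HasStrictFDerivAt N (((fderiv ℝ f b₀).compLeftContinuousBounded ℕ).comp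
        (ContinuousLinearMap.fst ℝ (ℕ →ᵇ Z) Z)) (0, b₀) ∧
      ∀ᶠ q in 𝓝 ((0 : ℕ →ᵇ Z), b₀), ∀ k : ℕ,
        N q k = (c ^ k)⁻¹ • (f (q.2 + c ^ k • q.1 k) - f q.2) := by
  obtain ⟨p, r, hp⟩ := hf
  set P := superpositionSeries p hc hc1 with hP
  have hPr : 0 < P.radius :=
    superpositionSeries_radius_pos (hp.r_pos.trans_le hp.r_le) hc hc1
  have hS := P.hasFPowerSeriesOnBall hPr
  have hN : HasFPowerSeriesAt (fun q => P.sum (q - (0, b₀))) P (0, b₀) := by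
    refine ⟨P.radius, ?_⟩
    simpa using hS.comp_sub (0, b₀)
  refine ⟨fun q => P.sum (q - (0, b₀)), hN.analyticAt, ?_, ?_⟩
  -- In the linear term the base point cancels and so do the weights, leaving the derivative of `f`
  -- applied to each `sₖ`.
  · have hfd : ∀ z, p 1 (fun _ => z) = fderiv ℝ f b₀ z := fun z => by
      rw [hp.hasFPowerSeriesAt.fderiv_eq, continuousMultilinearCurryFin1_apply]
      congr 1
    have heq : ((fderiv ℝ f b₀).compLeftContinuousBounded ℕ).comp
        (ContinuousLinearMap.fst ℝ (ℕ →ᵇ Z) Z) =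
        continuousMultilinearCurryFin1 ℝ ((ℕ →ᵇ Z) × Z) (ℕ →ᵇ F) (P 1) := by
      refine ContinuousLinearMap.ext fun q => BoundedContinuousFunction.ext fun k => ?_
      have hq : continuousMultilinearCurryFin1 ℝ ((ℕ →ᵇ Z) × Z) (ℕ →ᵇ F) (P 1) q =
          P 1 (fun _ => q) := by
        rw [continuousMultilinearCurryFin1_apply]
        congr 1
      have hck : c ^ k ≠ 0 := (pow_pos hc k).ne'
      rw [hq, hP, superpositionSeries_apply]
      simp [hfd, smul_smul, inv_mul_cancel₀ hck]
    rw [heq]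
    exact hN.hasStrictFDerivAt
  · have htend : Tendsto (fun q : (ℕ →ᵇ Z) × Z => q - (0, b₀)) (𝓝 (0, b₀)) (𝓝 0) := by
      simpa using! (continuous_id.sub (continuous_const (y := ((0 : ℕ →ᵇ Z), b₀)))).tendsto (0, b₀)
    obtain ⟨ρ, hρ0, hρ⟩ := ENNReal.lt_iff_exists_nnreal_btwn.1 hp.r_pos
    have hρ0 : (0 : ℝ) < ρ := by exact_mod_cast hρ0
    have hmem : ∀ z : Z, ‖z‖ < ρ → z ∈ Metric.eball (0 : Z) r := fun z hz => by
      refine lt_trans ?_ hρ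
      rw [edist_zero_right, ← ofReal_norm, ← ENNReal.ofReal_coe_nnreal]
      exact (ENNReal.ofReal_lt_ofReal_iff hρ0).2 hz
    filter_upwards [htend (Metric.eball_mem_nhds _ hPr),
      htend (Metric.ball_mem_nhds _ (half_pos hρ0))] with q hq hq' k
    have hq'' : ‖q - (0, b₀)‖ < ρ / 2 := by simpa using! hq'
    have h1 : ‖q.1‖ < ρ / 2 := by
      have := (norm_fst_le (q - (0, b₀))).trans_lt hq''
      simpa using! this
    have h2 : ‖q.2 - b₀‖ < ρ / 2 := (norm_snd_le (q - (0, b₀))).trans_lt hq''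
    have h3 : ‖q.2 - b₀ + c ^ k • q.1 k‖ < ρ := by
      refine (norm_add_le _ _).trans_lt ?_
      have : ‖c ^ k • q.1 k‖ ≤ ‖q.1‖ := by
        rw [norm_smul, Real.norm_of_nonneg (pow_pos hc k).le]
        exact (mul_le_of_le_one_left (norm_nonneg _) (pow_le_one₀ hc.le hc1)).trans
          (q.1.norm_coe_le_norm k)
      linarith
    -- Both endpoints lie in the ball of convergence of `f`, so subtracting the two expansions gives
    -- the `k`-th coordinate of the series.
    have s1 := hp.hasSum (hmem _ h3)
    have s2 := hp.hasSum (hmem _ (h2.trans (by linarith)))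
    have s3 := ((hS.hasSum hq).mapL (BoundedContinuousFunction.evalCLM ℝ k))
    have s4 := (s1.sub s2).const_smul (c ^ k)⁻¹
    have e1 : b₀ + (q.2 - b₀ + c ^ k • q.1 k) = q.2 + c ^ k • q.1 k := by abel
    rw [e1, add_sub_cancel] at s4
    refine HasSum.unique ?_ s4
    convert! s3 using 1
    · ext j
      simp [hP, superpositionSeries_apply]
    · simp

end Superposition

/-! ### Operators and quadratic forms on sequence spaces. -/

section SequenceSpace

variable {X : Type*} [NormedAddCommGroup X]

/-- The weighted right shift `(u₀, u₁, …) ↦ (0, a u₀, a u₁, …)` on bounded sequences. -/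
noncomputable def weightedShift [NormedSpace ℝ X] (a : ℝ) : (ℕ →ᵇ X) →L[ℝ] (ℕ →ᵇ X) :=
  LinearMap.mkContinuous
    { toFun := fun u => BoundedContinuousFunction.ofNormedAddCommGroupDiscrete
        (fun k => Nat.casesOn k 0 fun l => a • u l) (|a| * ‖u‖) fun k => by
          cases k with
          | zero => simpa using by positivity
          | succ l => simpa [norm_smul] using
              mul_le_mul_of_nonneg_left (u.norm_coe_le_norm l) (abs_nonneg a)
      map_add' := fun u v => by
        ext k
        cases k <;> simp
      map_smul' := fun b u => by
        ext k
        cases k <;> simp [smul_comm a b] }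
    |a| fun u => by
      refine (BoundedContinuousFunction.norm_le (by positivity)).2 fun k => ?_
      cases k with
      | zero => simpa using by positivity
      | succ l => simpa [norm_smul] using
          mul_le_mul_of_nonneg_left (u.norm_coe_le_norm l) (abs_nonneg a)

@[simp] theorem weightedShift_apply_zero [NormedSpace ℝ X] (a : ℝ) (u : ℕ →ᵇ X) :
    weightedShift a u 0 = 0 := rfl

@[simp] theorem weightedShift_apply_succ [NormedSpace ℝ X] (a : ℝ) (u : ℕ →ᵇ X) (k : ℕ) :
    weightedShift a u (k + 1) = a • u k := rfl

theorem norm_weightedShift_apply_le [NormedSpace ℝ X] (a : ℝ) (u : ℕ →ᵇ X) :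
    ‖weightedShift a u‖ ≤ |a| * ‖u‖ :=
  ContinuousLinearMap.le_of_opNorm_le _ (LinearMap.mkContinuous_norm_le _ (abs_nonneg a) _) u

/-- The bounded sequence `(y, 0, 0, …)`. -/
noncomputable def headSeq [NormedSpace ℝ X] : X →L[ℝ] (ℕ →ᵇ X) :=
  LinearMap.mkContinuous
    { toFun := fun y => BoundedContinuousFunction.ofNormedAddCommGroupDiscrete
        (fun k => Nat.casesOn k y fun _ => 0) ‖y‖ fun k => by cases k <;> simp
      map_add' := fun u v => by
        ext k
        cases k <;> simp
      map_smul' := fun b u => by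
        ext k
        cases k <;> simp }
    1 fun y => by
      refine (BoundedContinuousFunction.norm_le (by positivity)).2 fun k => ?_
      cases k <;> simp

@[simp] theorem headSeq_apply_zero [NormedSpace ℝ X] (y : X) : headSeq y 0 = y := rfl

@[simp] theorem headSeq_apply_succ [NormedSpace ℝ X] (y : X) (k : ℕ) :
    headSeq y (k + 1) = 0 := rfl

/-- The summands are diagonals of bilinear forms of norm at most `c²ᵏ`. These forms sum in operator
norm, and the diagonal of the resulting continuous bilinear form is analytic. -/
theorem analyticAt_tsum_weighted_norm_sq [InnerProductSpace ℝ X] {W : Type*}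
    [NormedAddCommGroup W] [NormedSpace ℝ W] {ev : ℕ → W →L[ℝ] X} (hev : ∀ k w, ‖ev k w‖ ≤ ‖w‖)
    {c : ℝ} (hc : 0 < c) (hc1 : c < 1) (w₀ : W) :
    AnalyticAt ℝ (fun w : W => ∑' k : ℕ, ‖c ^ k • ev k w‖ ^ 2) w₀ := by
  obtain ⟨B, hBa⟩ : ∃ B : ℕ → W →L[ℝ] W →L[ℝ] ℝ,
      ∀ k u v, B k u v = inner ℝ (c ^ k • ev k u) (c ^ k • ev k v) :=
    ⟨fun k => (innerSL ℝ).bilinearComp (c ^ k • ev k) (c ^ k • ev k), fun k u v => by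
      rw [ContinuousLinearMap.bilinearComp_apply, innerSL_apply_apply]; rfl⟩
  have hBn : ∀ k, ‖B k‖ ≤ (c ^ 2) ^ k := fun k => by
    refine ContinuousLinearMap.opNorm_le_bound₂ _ (by positivity) fun u v => ?_
    have hk : ∀ w : W, ‖c ^ k • ev k w‖ ≤ c ^ k * ‖w‖ := fun w => by
      rw [norm_smul, Real.norm_of_nonneg (pow_pos hc k).le]
      gcongr
      exact hev k w
    calc ‖B k u v‖ = ‖inner ℝ (c ^ k • ev k u) (c ^ k • ev k v)‖ := by rw [hBa]
      _ ≤ ‖c ^ k • ev k u‖ * ‖c ^ k • ev k v‖ := norm_inner_le_norm _ _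
      _ ≤ (c ^ k * ‖u‖) * (c ^ k * ‖v‖) := mul_le_mul (hk u) (hk v) (norm_nonneg _) (by positivity)
      _ = (c ^ 2) ^ k * ‖u‖ * ‖v‖ := by ring
  have hgeo : Summable fun k : ℕ => (c ^ 2) ^ k :=
    summable_geometric_of_lt_one (by positivity) (pow_lt_one₀ hc.le hc1 two_ne_zero)
  have hcomplete : CompleteSpace (W →L[ℝ] W →L[ℝ] ℝ) := inferInstance
  have hB : Summable B :=
    @Summable.of_norm_bounded ℕ (W →L[ℝ] W →L[ℝ] ℝ) _ hcomplete _ _ hgeo hBn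
  have happ : ∀ w, HasSum (fun k => B k w w) ((∑' k, B k) w w) := fun w => by
    let L : (W →L[ℝ] W →L[ℝ] ℝ) →L[ℝ] ℝ :=
      (ContinuousLinearMap.apply ℝ ℝ w).comp (ContinuousLinearMap.apply ℝ (W →L[ℝ] ℝ) w)
    exact hB.hasSum.mapL L
  have heq : (fun w : W => ∑' k : ℕ, ‖c ^ k • ev k w‖ ^ 2) = fun w => (∑' k, B k) w w := by
    ext w
    rw [← (happ w).tsum_eq]
    exact tsum_congr fun k => by rw [hBa, real_inner_self_eq_norm_sq]
  rw [heq]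
  exact ((∑' k, B k).analyticAt_bilinear (w₀, w₀)).comp₂ analyticAt_id analyticAt_id

end SequenceSpace

/-! ### Inversion of analytic perturbations of the identity. -/

section InverseFunction

variable {W : Type*} [NormedAddCommGroup W] [NormedSpace ℝ W] [CompleteSpace W]

/-- Inverse function theorem for an analytic perturbation of the identity: near `w₀` the map `Ψ`
has an analytic left inverse. -/
theorem exists_analytic_leftInverse {Ψ : W → W} {w₀ : W} {T : W →L[ℝ] W} (hT : ‖T‖ < 1)
    (hΨ : AnalyticAt ℝ Ψ w₀) (hd : HasStrictFDerivAt Ψ (1 - T) w₀) :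
    ∃ S : W → W, AnalyticAt ℝ S (Ψ w₀) ∧ ∀ᶠ w in 𝓝 w₀, S (Ψ w) = w := by
  let e : W ≃L[ℝ] W := ContinuousLinearEquiv.unitsEquiv ℝ W (Units.oneSub T hT)
  have he : (e : W →L[ℝ] W) = 1 - T := rfl
  rw [← he] at hd
  refine ⟨(hd.toOpenPartialHomeomorph Ψ).symm, ?_, hd.eventually_left_inverse⟩
  exact (hd.toOpenPartialHomeomorph Ψ).analyticAt_symm' (i := e)
    hd.mem_toOpenPartialHomeomorph_source hΨ hd.hasFDerivAt.fderiv

end InverseFunction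

/-! ### Uniform contraction and local analyticity of the Lyapunov function. -/

theorem iter_succ {n m : ℕ} (f : E n × E m → E n) (α : E m) (k : ℕ) (x : E n) :
    iter f α (k + 1) x = f (iter f α k x, α) :=
  Function.iterate_succ_apply' _ k x

/-- A fixed point of `f (·, α₀)` with partial derivative of norm less than `c` attracts, with
rate `c`, uniformly for parameters near `α₀`. -/
theorem exists_eventually_contracting {X Y : Type*} [NormedAddCommGroup X] [NormedSpace ℝ X]
    [NormedAddCommGroup Y] [NormedSpace ℝ Y] {f : X × Y → X} {φ : Y → X} {α₀ : Y}
    {f' : X × Y →L[ℝ] X} (hf : HasStrictFDerivAt f f' (φ α₀, α₀)) (hφ : ContinuousAt φ α₀)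
    (hfix : ∀ᶠ α in 𝓝 α₀, f (φ α, α) = φ α) {c : ℝ}
    (hc : ‖f'.comp (ContinuousLinearMap.inl ℝ X Y)‖ < c) :
    ∃ r > 0, ∀ᶠ α in 𝓝 α₀, ∀ x ∈ Metric.ball (φ α) r, ‖f (x, α) - φ α‖ ≤ c * ‖x - φ α‖ := by
  -- Strict differentiability is needed because the base point `φ α` moves with `α`; the slack `c -
  -- ‖∂ₓf‖` is the error allowed.
  have h := (hasStrictFDerivAt_iff_isLittleO.1 hf).def (sub_pos.2 hc)
  obtain ⟨ρ, hρ, h⟩ := Metric.eventually_nhds_iff.1 h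
  refine ⟨ρ / 2, half_pos hρ, ?_⟩
  filter_upwards [hfix, Metric.ball_mem_nhds α₀ hρ, hφ (Metric.ball_mem_nhds _ (half_pos hρ))]
    with α hα hα₀ hφα x hx
  have hφα : dist (φ α) (φ α₀) < ρ / 2 := hφα
  have hx : dist x (φ α) < ρ / 2 := hx
  have hxφ : dist x (φ α₀) < ρ := by linarith [dist_triangle x (φ α) (φ α₀)]
  have key := @h ((x, α), (φ α, α)) (by
    simp only [Prod.dist_eq]
    exact max_lt (max_lt hxφ hα₀) (max_lt (by linarith) hα₀))
  have e1 : ((x, α) : X × Y) - (φ α, α) = ContinuousLinearMap.inl ℝ X Y (x - φ α) := by simp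
  have e2 : ‖ContinuousLinearMap.inl ℝ X Y (x - φ α)‖ = ‖x - φ α‖ := by simp [Prod.norm_def]
  simp only [e1, e2, hα] at key
  have h3 := (f'.comp (ContinuousLinearMap.inl ℝ X Y)).le_opNorm (x - φ α)
  have h4 := norm_le_insert' (f (x, α) - φ α) (f' (ContinuousLinearMap.inl ℝ X Y (x - φ α)))
  rw [ContinuousLinearMap.comp_apply] at h3
  linarith

theorem norm_iter_sub_le {n m : ℕ} {f : E n × E m → E n} {α : E m} {a : E n} {c r : ℝ}
    (hc : 0 ≤ c) (hc1 : c ≤ 1)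
    (h : ∀ x ∈ Metric.ball a r, ‖f (x, α) - a‖ ≤ c * ‖x - a‖) {x : E n} (hx : x ∈ Metric.ball a r)
    (k : ℕ) : ‖iter f α k x - a‖ ≤ c ^ k * ‖x - a‖ := by
  induction k with
  | zero => simp [iter]
  | succ k ih =>
    have hk : iter f α k x ∈ Metric.ball a r := by
      rw [mem_ball_iff_norm] at hx ⊢
      exact (ih.trans (mul_le_of_le_one_left (norm_nonneg _) (pow_le_one₀ hc hc1))).trans_lt hx
    rw [iter_succ, pow_succ']
    calc _ ≤ c * ‖iter f α k x - a‖ := h _ hk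
      _ ≤ c * (c ^ k * ‖x - a‖) := by gcongr
      _ = _ := by ring

theorem fderiv_prodMk_right_eq {X Y F : Type*} [NormedAddCommGroup X] [NormedSpace ℝ X]
    [NormedAddCommGroup Y] [NormedSpace ℝ Y] [NormedAddCommGroup F] [NormedSpace ℝ F]
    {f : X × Y → F} {x : X} {y : Y} (hf : DifferentiableAt ℝ f (x, y)) :
    fderiv ℝ (fun x => f (x, y)) x = (fderiv ℝ f (x, y)).comp (ContinuousLinearMap.inl ℝ X Y) :=
  (hf.hasFDerivAt.comp x (hasFDerivAt_prodMk_left x y)).fderiv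

/-- Near a contracting fixed point, the Lyapunov function is jointly analytic: the rescaled orbit
solves an analytic equation in the space of bounded sequences, with invertible linearization. -/
theorem analyticAt_V_of_contracting {n m : ℕ} {f : E n × E m → E n} {φ : E m → E n} {α₀ : E m}
    (hf : AnalyticAt ℝ f (φ α₀, α₀)) (hφ : AnalyticAt ℝ φ α₀)
    (hfix : ∀ᶠ α in 𝓝 α₀, f (φ α, α) = φ α)
    (hcontr : ‖fderiv ℝ (fun x => f (x, α₀)) (φ α₀)‖ < 1) :
    AnalyticAt ℝ (V f φ) (φ α₀, α₀) := by
  rw [fderiv_prodMk_right_eq hf.differentiableAt] at hcontr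
  obtain ⟨c, hAc, hc1⟩ := exists_between hcontr
  have hc : 0 < c := (norm_nonneg _).trans_lt hAc
  set A := (fderiv ℝ f (φ α₀, α₀)).comp (ContinuousLinearMap.inl ℝ (E n) (E m)) with hA
  obtain ⟨r, hr, hcon⟩ :=
    exists_eventually_contracting hf.hasStrictFDerivAt hφ.continuousAt hfix hAc
  obtain ⟨N, hN, hNd, hNe⟩ := exists_analytic_superposition hf hc hc1.le
  let ι : (ℕ →ᵇ E n) →L[ℝ] (ℕ →ᵇ E n × E m) :=
    (ContinuousLinearMap.inl ℝ (E n) (E m)).compLeftContinuousBounded ℕ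
  let J : (ℕ →ᵇ E n) × E m → (ℕ →ᵇ E n × E m) × (E n × E m) := fun w => (ι w.1, (φ w.2, w.2))
  have hJ0 : J (0, α₀) = (0, (φ α₀, α₀)) := by simp [J]
  have hJ : AnalyticAt ℝ J (0, α₀) := by
    have h1 : AnalyticAt ℝ (fun w : (ℕ →ᵇ E n) × E m => ι w.1) (0, α₀) :=
      (ι.analyticAt _).comp analyticAt_fst
    have h2 : AnalyticAt ℝ (fun w : (ℕ →ᵇ E n) × E m => φ w.2) (0, α₀) :=
      AnalyticAt.comp (g := φ) (f := Prod.snd) hφ analyticAt_snd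
    exact h1.prod (h2.prod analyticAt_snd)
  let R : (ℕ →ᵇ E n) →L[ℝ] (ℕ →ᵇ E n) := weightedShift c⁻¹
  -- Coordinate `k + 1` of the first component vanishes exactly when `u` obeys the rescaled
  -- recursion at step `k`; coordinate `0` is the initial value.
  let Ψ : (ℕ →ᵇ E n) × E m → (ℕ →ᵇ E n) × E m := fun w => (w.1 - R (N (J w)), w.2)
  have hNJ : AnalyticAt ℝ (fun w => N (J w)) (0, α₀) :=
    AnalyticAt.comp (g := N) (by rw [hJ0]; exact hN) hJ
  have hΨ : AnalyticAt ℝ Ψ (0, α₀) :=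
    (analyticAt_fst.sub ((R.analyticAt _).comp hNJ)).prod analyticAt_snd
  let T₁ : (ℕ →ᵇ E n) →L[ℝ] (ℕ →ᵇ E n) := R.comp (A.compLeftContinuousBounded ℕ)
  let T : (ℕ →ᵇ E n) × E m →L[ℝ] (ℕ →ᵇ E n) × E m :=
    (ContinuousLinearMap.inl ℝ _ _).comp (T₁.comp (ContinuousLinearMap.fst ℝ _ _))
  have hT : ‖T‖ < 1 := by
    have hq : c⁻¹ * ‖A‖ < 1 := by rw [inv_mul_lt_one₀ hc]; exact hAc
    refine lt_of_le_of_lt (ContinuousLinearMap.opNorm_le_bound _ (by positivity) fun w => ?_) hq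
    have hAw : ‖A.compLeftContinuousBounded ℕ w.1‖ ≤ ‖A‖ * ‖w‖ := by
      refine (BoundedContinuousFunction.norm_le (by positivity)).2 fun k => ?_
      refine (A.le_opNorm (w.1 k)).trans ?_
      gcongr
      exact (w.1.norm_coe_le_norm k).trans (norm_fst_le w)
    calc ‖T w‖ = ‖R (A.compLeftContinuousBounded ℕ w.1)‖ := by
          simp [T, T₁, Prod.norm_def]
      _ ≤ |c⁻¹| * ‖A.compLeftContinuousBounded ℕ w.1‖ := norm_weightedShift_apply_le _ _
      _ ≤ c⁻¹ * (‖A‖ * ‖w‖) := by rw [abs_of_pos (inv_pos.2 hc)]; gcongr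
      _ = _ := by ring
  -- The derivative of `N` ignores the base-point direction, so the derivative of `φ` drops out.
  have hΨd : HasStrictFDerivAt Ψ (1 - T) (0, α₀) := by
    have hι : HasStrictFDerivAt (fun w : (ℕ →ᵇ E n) × E m => ι w.1)
        (ι.comp (ContinuousLinearMap.fst ℝ (ℕ →ᵇ E n) (E m))) (0, α₀) :=
      (ι.comp (ContinuousLinearMap.fst ℝ (ℕ →ᵇ E n) (E m))).hasStrictFDerivAt
    have hφd : HasStrictFDerivAt (fun w : (ℕ →ᵇ E n) × E m => (φ w.2, w.2)) _ (0, α₀) :=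
      (HasStrictFDerivAt.comp (g := φ) (f := Prod.snd) (0, α₀) hφ.hasStrictFDerivAt
        hasStrictFDerivAt_snd).prodMk hasStrictFDerivAt_snd
    have hNJd := HasStrictFDerivAt.comp (g := N) (f := J) (0, α₀) (by rw [hJ0]; exact hNd)
      (hι.prodMk hφd)
    have hd := (hasStrictFDerivAt_fst.sub
      (R.hasStrictFDerivAt.comp (0, α₀) hNJd)).prodMk hasStrictFDerivAt_snd
    refine hd.congr_fderiv (ContinuousLinearMap.ext fun w => Prod.ext ?_ ?_)
    · refine BoundedContinuousFunction.ext fun k => ?_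
      cases k <;> simp [T, T₁, R, ι, hA]
    · simp [T]
  obtain ⟨S, hS, hSe⟩ := exists_analytic_leftInverse hT hΨ hΨd
  have hΨ0 : Ψ (0, α₀) = (0, α₀) := by
    have : N (J (0, α₀)) = 0 := by
      rw [hJ0]
      ext k : 1
      simp [hNe.self_of_nhds k]
    simp [Ψ, this]
  rw [hΨ0] at hS
  have hin : AnalyticAt ℝ (fun p : E n × E m => (headSeq (p.1 - φ p.2), p.2)) (φ α₀, α₀) := by
    have h2 : AnalyticAt ℝ (fun p : E n × E m => φ p.2) (φ α₀, α₀) :=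
      AnalyticAt.comp (g := φ) (f := Prod.snd) hφ analyticAt_snd
    exact (((headSeq (X := E n)).analyticAt _).comp (analyticAt_fst.sub h2)).prod analyticAt_snd
  have hSin : AnalyticAt ℝ (fun p : E n × E m => (S (headSeq (p.1 - φ p.2), p.2)).1)
      (φ α₀, α₀) := by
    refine analyticAt_fst.comp (AnalyticAt.comp (g := S) ?_ hin)
    simpa using hS
  have hQ := AnalyticAt.comp (analyticAt_tsum_weighted_norm_sq
    (ev := fun k => BoundedContinuousFunction.evalCLM (β := E n) ℝ k)
    (fun k w => w.norm_coe_le_norm k) hc hc1 _) hSin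
  refine hQ.congr ?_
  have hJe := hJ.continuousAt.tendsto.eventually (hJ0.symm ▸ hNe)
  obtain ⟨ρ, hρ, hball⟩ := Metric.eventually_nhds_iff.1 (hSe.and hJe)
  have hsnd : Tendsto (fun p : E n × E m => p.2) (𝓝 (φ α₀, α₀)) (𝓝 α₀) :=
    continuous_snd.tendsto _
  have hdiff : Tendsto (fun p : E n × E m => ‖p.1 - φ p.2‖) (𝓝 (φ α₀, α₀)) (𝓝 0) := by
    have h2 : Tendsto (fun p : E n × E m => φ p.2) (𝓝 (φ α₀, α₀)) (𝓝 (φ α₀)) :=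
      hφ.continuousAt.tendsto.comp hsnd
    have h1 : Tendsto (fun p : E n × E m => p.1) (𝓝 (φ α₀, α₀)) (𝓝 (φ α₀)) :=
      continuous_fst.tendsto _
    simpa using (h1.sub h2).norm
  filter_upwards [hsnd.eventually hcon, hsnd.eventually hfix,
    hsnd.eventually (Metric.ball_mem_nhds α₀ hρ), hdiff.eventually (gt_mem_nhds hr),
    hdiff.eventually (gt_mem_nhds hρ)]
  rintro ⟨x, α⟩ hα hfixα hαρ hxr hxρ
  simp only at hα hfixα hαρ hxr hxρ
  have hck : ∀ k : ℕ, c ^ k ≠ 0 := fun k => (pow_pos hc k).ne'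
  have horb : ∀ k, ‖(c ^ k)⁻¹ • (iter f α k x - φ α)‖ ≤ ‖x - φ α‖ := fun k => by
    have := norm_iter_sub_le hc.le hc1.le hα (mem_ball_iff_norm.2 hxr) k
    rw [norm_smul, norm_inv, Real.norm_of_nonneg (pow_pos hc k).le,
      inv_mul_le_iff₀ (pow_pos hc k)]
    exact this
  let u : ℕ →ᵇ E n := BoundedContinuousFunction.ofNormedAddCommGroupDiscrete
    (fun k => (c ^ k)⁻¹ • (iter f α k x - φ α)) ‖x - φ α‖ horb
  have hu : ∀ k, c ^ k • u k = iter f α k x - φ α := fun k => smul_inv_smul₀ (hck k) _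
  have hun : ‖u‖ ≤ ‖x - φ α‖ := (BoundedContinuousFunction.norm_le (norm_nonneg _)).2 horb
  -- The rescaled orbit has norm at most `‖x - φ α‖`, so it is small enough for the local left
  -- inverse to recover it.
  obtain ⟨hSu, hNu⟩ := @hball (u, α) (by
    rw [Prod.dist_eq]
    exact max_lt (by simpa using hun.trans_lt hxρ) hαρ)
  have hΨu : Ψ (u, α) = (headSeq (x - φ α), α) := by
    refine Prod.ext ?_ rfl
    refine BoundedContinuousFunction.ext fun k => ?_
    cases k with
    | zero => simp [Ψ, R, u, iter]
    | succ k =>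
      have h1 : N (J (u, α)) k = (c ^ k)⁻¹ • (iter f α (k + 1) x - φ α) := by
        rw [hNu k, iter_succ]
        congr 2
        · congr 1
          refine Prod.ext ?_ ?_
          · change φ α + c ^ k • u k = _
            rw [hu]; abel
          · change α + c ^ k • (0 : E m) = α
            simp
      simp [Ψ, R, h1, u, smul_smul, pow_succ', mul_comm]
  rw [hΨu] at hSu
  simp only [Function.comp_apply, hSu, V]
  exact tsum_congr fun k => by
    rw [← hu k]; rfl

/-! ### From neighbourhoods of the path to the whole domain of attraction. -/

section Global

variable {n m : ℕ} {Ω : Set (E n)} {D₁ : Set (E m)} {f : E n × E m → E n} {φ : E m → E n}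

theorem mem_G {p : E n × E m} : p ∈ G Ω D₁ f φ ↔ p.2 ∈ D₁ ∧ p.1 ∈ DA Ω f p.2 (φ p.2) := by
  obtain ⟨x, α⟩ := p
  simp [G, and_comm]

theorem iter_add (f : E n × E m → E n) (α : E m) (j k : ℕ) (x : E n) :
    iter f α (j + k) x = iter f α j (iter f α k x) :=
  Function.iterate_add_apply _ j k x

theorem iter_mem (hfΩ : ∀ α ∈ D₁, ∀ x ∈ Ω, f (x, α) ∈ Ω) {α : E m} (hα : α ∈ D₁) {x : E n}
    (hx : x ∈ Ω) (k : ℕ) : iter f α k x ∈ Ω := by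
  induction k with
  | zero => exact hx
  | succ k ih => rw [iter_succ]; exact hfΩ α hα _ ih

theorem analyticOnNhd_iter (hf : AnalyticOnNhd ℝ f (Ω ×ˢ D₁))
    (hfΩ : ∀ α ∈ D₁, ∀ x ∈ Ω, f (x, α) ∈ Ω) (k : ℕ) :
    AnalyticOnNhd ℝ (fun p : E n × E m => iter f p.2 k p.1) (Ω ×ˢ D₁) := by
  induction k with
  | zero => exact fun p _ => analyticAt_fst
  | succ k ih =>
    intro p hp
    simp only [iter_succ]
    exact AnalyticAt.comp (g := f) (hf _ ⟨iter_mem hfΩ hp.2 hp.1 k, hp.2⟩)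
      ((ih p hp).prod analyticAt_snd)

theorem mem_DA_of_iter_mem_DA {α : E m} {a x : E n} (hx : x ∈ Ω) {k : ℕ}
    (h : iter f α k x ∈ DA Ω f α a) : x ∈ DA Ω f α a := by
  refine ⟨hx, (tendsto_add_atTop_iff_nat k).1 ?_⟩
  simpa only [iter_add] using h.2

theorem iter_mem_DA (hfΩ : ∀ α ∈ D₁, ∀ x ∈ Ω, f (x, α) ∈ Ω) {α : E m} (hα : α ∈ D₁) {a x : E n}
    (h : x ∈ DA Ω f α a) (k : ℕ) : iter f α k x ∈ DA Ω f α a := by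
  refine ⟨iter_mem hfΩ hα h.1 k, ?_⟩
  have := (tendsto_add_atTop_iff_nat k).2 h.2
  simpa only [iter_add] using this

theorem exists_iter_mem {S : Set (E n × E m)} {p : E n × E m} (hp : p ∈ G Ω D₁ f φ)
    (hS : S ∈ 𝓝 (φ p.2, p.2)) : ∃ k, (iter f p.2 k p.1, p.2) ∈ S := by
  have h : Tendsto (fun k => (iter f p.2 k p.1, p.2)) atTop (𝓝 (φ p.2, p.2)) :=
    (mem_G.1 hp).2.2.prodMk_nhds tendsto_const_nhds
  exact (h.eventually hS).exists

/-- Near the path of steady states every point is attracted, with a convergent series. -/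
theorem eventually_mem_G_and_summable (hΩ : IsOpen Ω) (hD₁ : IsOpen D₁)
    (hf : AnalyticOnNhd ℝ f (Ω ×ˢ D₁)) (hφ : AnalyticOnNhd ℝ φ D₁)
    (hss : ∀ α ∈ D₁, IsSteadyState Ω f α (φ α))
    (hcontr : ∀ α ∈ D₁, ‖fderiv ℝ (fun x => f (x, α)) (φ α)‖ < 1) {α₀ : E m} (hα₀ : α₀ ∈ D₁) :
    ∀ᶠ p in 𝓝 (φ α₀, α₀), p ∈ G Ω D₁ f φ ∧
      Summable fun k : ℕ => ‖iter f p.2 k p.1 - φ p.2‖ ^ 2 := by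
  have hfa := hf (φ α₀, α₀) ⟨(hss α₀ hα₀).1, hα₀⟩
  have hc := hcontr α₀ hα₀
  rw [fderiv_prodMk_right_eq hfa.differentiableAt] at hc
  obtain ⟨c, hAc, hc1⟩ := exists_between hc
  have hc0 : 0 ≤ c := (norm_nonneg _).trans hAc.le
  have hDn : ∀ᶠ α in 𝓝 α₀, α ∈ D₁ := hD₁.mem_nhds hα₀
  -- The radius `r` does not depend on `α`, which yields a neighbourhood in the product space.
  obtain ⟨r, hr, hcon⟩ := exists_eventually_contracting hfa.hasStrictFDerivAt
    (hφ α₀ hα₀).continuousAt (hDn.mono fun α hα => (hss α hα).2) hAc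
  have hsnd : Tendsto (fun p : E n × E m => p.2) (𝓝 (φ α₀, α₀)) (𝓝 α₀) :=
    continuous_snd.tendsto _
  have hfst : Tendsto (fun p : E n × E m => p.1) (𝓝 (φ α₀, α₀)) (𝓝 (φ α₀)) :=
    continuous_fst.tendsto _
  have hdist : Tendsto (fun p : E n × E m => dist p.1 (φ p.2)) (𝓝 (φ α₀, α₀)) (𝓝 0) := by
    simpa using hfst.dist ((hφ α₀ hα₀).continuousAt.tendsto.comp hsnd)
  filter_upwards [hsnd.eventually hcon, hsnd.eventually hDn,
    hfst.eventually (hΩ.mem_nhds (hss α₀ hα₀).1), hdist.eventually (gt_mem_nhds hr)]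
    with p hp hpD hpΩ hpr
  have hb := norm_iter_sub_le hc0 hc1.le hp hpr
  have hlim : Tendsto (fun k : ℕ => c ^ k * ‖p.1 - φ p.2‖) atTop (𝓝 0) := by
    simpa using (tendsto_pow_atTop_nhds_zero_of_lt_one hc0 hc1).mul_const ‖p.1 - φ p.2‖
  refine ⟨mem_G.2 ⟨hpD, hpΩ, ?_⟩, ?_⟩
  · exact tendsto_iff_norm_sub_tendsto_zero.2
      (squeeze_zero (fun _ => norm_nonneg _) hb hlim)
  · have hgeo : Summable fun k : ℕ => (c ^ 2) ^ k * ‖p.1 - φ p.2‖ ^ 2 :=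
      (summable_geometric_of_lt_one (sq_nonneg c) (pow_lt_one₀ hc0 hc1 two_ne_zero)).mul_right _
    refine hgeo.of_nonneg_of_le (fun _ => sq_nonneg _) fun k => ?_
    calc _ ≤ (c ^ k * ‖p.1 - φ p.2‖) ^ 2 := by gcongr; exact hb k
      _ = _ := by ring

theorem summable_of_summable_iter {p : E n × E m} {k : ℕ}
    (h : Summable fun j : ℕ => ‖iter f p.2 j (iter f p.2 k p.1) - φ p.2‖ ^ 2) :
    Summable fun j : ℕ => ‖iter f p.2 j p.1 - φ p.2‖ ^ 2 := by
  refine (summable_nat_add_iff k).1 ?_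
  simpa only [iter_add] using h

theorem V_eq_sum_add {p : E n × E m}
    (h : Summable fun j : ℕ => ‖iter f p.2 j p.1 - φ p.2‖ ^ 2) (k : ℕ) :
    V f φ p = ∑ j ∈ Finset.range k, ‖iter f p.2 j p.1 - φ p.2‖ ^ 2 +
      V f φ (iter f p.2 k p.1, p.2) := by
  simp only [V, ← iter_add]
  exact (h.sum_add_tsum_nat_add k).symm

/-- Some iterate lands in the interior of `G`; pull this back by continuity of that iterate. -/
theorem isOpen_G (hΩ : IsOpen Ω) (hD₁ : IsOpen D₁) (hf : AnalyticOnNhd ℝ f (Ω ×ˢ D₁))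
    (hfΩ : ∀ α ∈ D₁, ∀ x ∈ Ω, f (x, α) ∈ Ω)
    (hnear : ∀ α ∈ D₁, G Ω D₁ f φ ∈ 𝓝 (φ α, α)) : IsOpen (G Ω D₁ f φ) := by
  refine isOpen_iff_eventually.2 fun p hp => ?_
  have hp' := mem_G.1 hp
  have hpm : p ∈ Ω ×ˢ D₁ := ⟨hp'.2.1, hp'.1⟩
  obtain ⟨k, hk⟩ := exists_iter_mem hp (eventually_mem_nhds_iff.2 (hnear p.2 hp'.1))
  have hcont : ContinuousAt (fun q : E n × E m => (iter f q.2 k q.1, q.2)) p :=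
    (analyticOnNhd_iter hf hfΩ k p hpm).continuousAt.prodMk continuousAt_snd
  filter_upwards [hcont hk, (hΩ.prod hD₁).mem_nhds hpm] with q hq hqm
  exact mem_G.2 ⟨hqm.2, mem_DA_of_iter_mem_DA hqm.1 (mem_G.1 hq).2⟩

/-- The index `k` is chosen at `p` alone, and the splitting of `V` after `k` terms holds on all of
the open set `G`. -/
theorem analyticOnNhd_V (hf : AnalyticOnNhd ℝ f (Ω ×ˢ D₁)) (hφ : AnalyticOnNhd ℝ φ D₁)
    (hfΩ : ∀ α ∈ D₁, ∀ x ∈ Ω, f (x, α) ∈ Ω) (hopen : IsOpen (G Ω D₁ f φ))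
    (hsum : ∀ p ∈ G Ω D₁ f φ, Summable fun k : ℕ => ‖iter f p.2 k p.1 - φ p.2‖ ^ 2)
    (hloc : ∀ α ∈ D₁, AnalyticAt ℝ (V f φ) (φ α, α)) :
    AnalyticOnNhd ℝ (V f φ) (G Ω D₁ f φ) := by
  intro p hp
  have hp' := mem_G.1 hp
  have hpm : p ∈ Ω ×ˢ D₁ := ⟨hp'.2.1, hp'.1⟩
  obtain ⟨k, hk⟩ := exists_iter_mem hp (hloc p.2 hp'.1).eventually_analyticAt
  have hit : ∀ j, AnalyticAt ℝ (fun q : E n × E m => iter f q.2 j q.1) p := fun j =>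
    analyticOnNhd_iter hf hfΩ j p hpm
  have hφp : AnalyticAt ℝ (fun q : E n × E m => φ q.2) p :=
    AnalyticAt.comp (g := φ) (f := Prod.snd) (hφ p.2 hp'.1) analyticAt_snd
  have hterm : ∀ j, AnalyticAt ℝ (fun q : E n × E m => ‖iter f q.2 j q.1 - φ q.2‖ ^ 2) p :=
    fun j => by
      simp only [← real_inner_self_eq_norm_sq]
      exact ((innerSL ℝ).analyticAt_bilinear _).comp₂ ((hit j).sub hφp) ((hit j).sub hφp)
  have htail : AnalyticAt ℝ (fun q : E n × E m => V f φ (iter f q.2 k q.1, q.2)) p :=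
    AnalyticAt.comp (g := V f φ) hk ((hit k).prod analyticAt_snd)
  refine ((Finset.analyticAt_fun_sum (Finset.range k) fun j _ => hterm j).add htail).congr ?_
  filter_upwards [hopen.mem_nhds hp] with q hq
  exact (V_eq_sum_add (hsum q hq) k).symm

/-- The orbit of a point of `Ω` on the frontier of the domain of attraction stays away from the
steady state, so partial sums of the series near it are large. -/
theorem tendsto_V_frontier (hf : AnalyticOnNhd ℝ f (Ω ×ˢ D₁))
    (hfΩ : ∀ α ∈ D₁, ∀ x ∈ Ω, f (x, α) ∈ Ω) {α : E m} (hα : α ∈ D₁)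
    (hopen : IsOpen (DA Ω f α (φ α))) (hmem : φ α ∈ DA Ω f α (φ α))
    (hsum : ∀ x ∈ DA Ω f α (φ α), Summable fun k : ℕ => ‖iter f α k x - φ α‖ ^ 2)
    {x₀ : E n} (hx₀ : x₀ ∈ Ω) (hfr : x₀ ∉ DA Ω f α (φ α)) :
    Tendsto (fun x => V f φ (x, α)) (𝓝[DA Ω f α (φ α)] x₀) atTop := by
  obtain ⟨r, hr, hball⟩ := Metric.isOpen_iff.1 hopen _ hmem
  have hfar : ∀ k, r ≤ ‖iter f α k x₀ - φ α‖ := fun k => by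
    by_contra! h
    exact hfr (mem_DA_of_iter_mem_DA hx₀ (hball (mem_ball_iff_norm.2 h)))
  refine tendsto_atTop.2 fun M => ?_
  obtain ⟨N, hN⟩ := exists_nat_gt (M / r ^ 2)
  have hcont : ContinuousAt
      (fun x => ∑ k ∈ Finset.range N, ‖iter f α k x - φ α‖ ^ 2) x₀ := by
    refine tendsto_finsetSum _ fun k _ => ?_
    have hk : ContinuousAt (fun x => iter f α k x) x₀ :=
      ContinuousAt.comp (g := fun p : E n × E m => iter f p.2 k p.1) (f := fun x => (x, α))
        (analyticOnNhd_iter hf hfΩ k (x₀, α) ⟨hx₀, hα⟩).continuousAt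
        (by fun_prop)
    exact ((hk.sub continuousAt_const).norm.pow 2)
  have hM : M < ∑ k ∈ Finset.range N, ‖iter f α k x₀ - φ α‖ ^ 2 := by
    calc M < N * r ^ 2 := (div_lt_iff₀ (by positivity)).1 hN
      _ = ∑ k ∈ Finset.range N, r ^ 2 := by simp
      _ ≤ _ := Finset.sum_le_sum fun k _ => by gcongr; exact hfar k
  filter_upwards [nhdsWithin_le_nhds (hcont.eventually (lt_mem_nhds hM)), self_mem_nhdsWithin]
    with x hx hxD
  exact hx.le.trans ((hsum x hxD).sum_le_tsum _ fun _ _ => sq_nonneg _)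

/-- A function analytic on the open set `U` that blows up at every point of `Ω` on the boundary
of `U` has `U` as its natural domain of analyticity in `Ω`. -/
theorem isNaturalDomain_of_tendsto_atTop {U : Set (E n)} {u : E n → ℝ} (hU : IsOpen U)
    (hUΩ : U ⊆ Ω) (hu : AnalyticOnNhd ℝ u U)
    (hblow : ∀ x₀ ∈ Ω, x₀ ∉ U → Tendsto u (𝓝[U] x₀) atTop) : IsNaturalDomain Ω U u := by
  refine ⟨hU, hUΩ, hu, fun U₁ U₂ v hU₁ hne hsub hU₂ hconn hU₂Ω hv heq => ?_⟩
  -- Equality of germs, not of values, makes `W` open. It is also closed in `U₂`: the identity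
  -- theorem on a ball treats limit points in `U`, and blow-up of `u` against continuity of `v`
  -- excludes the others.
  let W : Set (E n) := {x | x ∈ U ∧ v =ᶠ[𝓝 x] u}
  have hWopen : IsOpen W := by
    refine isOpen_iff_eventually.2 fun x hx => ?_
    filter_upwards [hU.mem_nhds hx.1, hx.2.eventuallyEq_nhds] with y h1 h2 using ⟨h1, h2⟩
  have hsubW : U₂ ⊆ W := by
    refine hconn.isPreconnected.subset_of_closure_inter_subset hWopen ?_ ?_
    · obtain ⟨x, hx⟩ := hne
      exact ⟨x, (hsub hx).1, (hsub hx).2, heq.eventuallyEq_of_mem (hU₁.mem_nhds hx)⟩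
    · rintro x ⟨hxW, hxU₂⟩
      by_cases hxU : x ∈ U
      · obtain ⟨ρ, hρ, hball⟩ := Metric.isOpen_iff.1 (hU.inter hU₂) x ⟨hxU, hxU₂⟩
        obtain ⟨y, hyW, hy⟩ := Metric.mem_closure_iff.1 hxW ρ hρ
        have hyb : y ∈ Metric.ball x ρ := by rwa [Metric.mem_ball, dist_comm]
        have := (hv.mono fun z hz => (hball hz).2).eqOn_of_preconnected_of_eventuallyEq
          (hu.mono fun z hz => (hball hz).1) (convex_ball x ρ).isPreconnected hyb hyW.2
        exact ⟨hxU, this.eventuallyEq_of_mem (Metric.ball_mem_nhds x hρ)⟩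
      · exfalso
        have hne : (𝓝[W] x).NeBot := mem_closure_iff_nhdsWithin_neBot.1 hxW
        have h1 : Tendsto u (𝓝[W] x) atTop :=
          (hblow x (hU₂Ω hxU₂) hxU).mono_left (nhdsWithin_mono x fun y hy => hy.1)
        have h2 : Tendsto v (𝓝[W] x) (𝓝 (v x)) :=
          (hv x hxU₂).continuousAt.tendsto.mono_left nhdsWithin_le_nhds
        have h3 : v =ᶠ[𝓝[W] x] u := by
          filter_upwards [self_mem_nhdsWithin] with y hy using hy.2.self_of_nhds
        exact not_tendsto_nhds_of_tendsto_atTop h1 _ (h2.congr' h3)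
  exact fun x hx => (hsubW hx).1

end Global

end ControlSystem

/-! ### Assembly of the statement. -/

theorem theorem2 {n m : ℕ} (Ω : Set (ControlSystem.E n)) (D D₁ : Set (ControlSystem.E m))
    (hΩ : IsOpen Ω) (hD : IsOpen D) (hD₁ : IsOpen D₁) (hD₁D : D₁ ⊆ D)
    (f : ControlSystem.E n × ControlSystem.E m → ControlSystem.E n)
    (hf : AnalyticOnNhd ℝ f (Ω ×ˢ D))
    (hfΩ : ∀ α ∈ D₁, ∀ x ∈ Ω, f (x, α) ∈ Ω)
    (φ : ControlSystem.E m → ControlSystem.E n)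
    (hφ : ControlSystem.IsStablePath Ω D₁ f φ)
    (hcontr : ∀ α ∈ D₁, ‖fderiv ℝ (fun x => f (x, α)) (φ α)‖ < 1) :
    IsOpen (ControlSystem.G Ω D₁ f φ) ∧
    ControlSystem.G Ω D₁ f φ ⊆ Ω ×ˢ D ∧
    (∀ α ∈ D₁, (φ α, α) ∈ ControlSystem.G Ω D₁ f φ) ∧
    (∀ p ∈ ControlSystem.G Ω D₁ f φ,
      Summable fun k : ℕ => ‖ControlSystem.iter f p.2 k p.1 - φ p.2‖ ^ 2) ∧
    AnalyticOnNhd ℝ (ControlSystem.V f φ) (ControlSystem.G Ω D₁ f φ) ∧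
    (∀ p ∈ ControlSystem.G Ω D₁ f φ, 0 ≤ ControlSystem.V f φ p) ∧
    (∀ (x : ControlSystem.E n) (α : ControlSystem.E m), (x, α) ∈ ControlSystem.G Ω D₁ f φ →
      (f (x, α), α) ∈ ControlSystem.G Ω D₁ f φ ∧
      ControlSystem.V f φ (f (x, α), α) - ControlSystem.V f φ (x, α) = -‖x - φ α‖ ^ 2) ∧
    (∀ α ∈ D₁, ControlSystem.V f φ (φ α, α) = 0) ∧
    (∀ α ∈ D₁, ControlSystem.IsNaturalDomain Ω (ControlSystem.DA Ω f α (φ α))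
      (fun x => ControlSystem.V f φ (x, α))) ∧
    (∀ α ∈ D₁, ∀ x₀ ∈ Ω ∩ frontier (ControlSystem.DA Ω f α (φ α)),
      Tendsto (fun x => ControlSystem.V f φ (x, α))
        (𝓝[ControlSystem.DA Ω f α (φ α)] x₀) atTop) := by
  have hf₁ : AnalyticOnNhd ℝ f (Ω ×ˢ D₁) := hf.mono (prod_mono_right hD₁D)
  obtain ⟨hφa, hφs⟩ := hφ
  have hss : ∀ α ∈ D₁, ControlSystem.IsSteadyState Ω f α (φ α) := fun α hα => (hφs α hα).1
  have hnear := fun α (hα : α ∈ D₁) =>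
    ControlSystem.eventually_mem_G_and_summable hΩ hD₁ hf₁ hφa hss hcontr hα
  have hopen := ControlSystem.isOpen_G hΩ hD₁ hf₁ hfΩ
    fun α hα => (hnear α hα).mono fun _ h => h.1
  have hpath : ∀ α ∈ D₁, (φ α, α) ∈ ControlSystem.G Ω D₁ f φ := fun α hα =>
    (hnear α hα).self_of_nhds.1
  have hsum : ∀ p ∈ ControlSystem.G Ω D₁ f φ,
      Summable fun k : ℕ => ‖ControlSystem.iter f p.2 k p.1 - φ p.2‖ ^ 2 := fun p hp => by
    obtain ⟨k, hk⟩ := ControlSystem.exists_iter_mem hp (hnear p.2 (ControlSystem.mem_G.1 hp).1)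
    exact ControlSystem.summable_of_summable_iter hk.2
  have hV : AnalyticOnNhd ℝ (ControlSystem.V f φ) (ControlSystem.G Ω D₁ f φ) := by
    refine ControlSystem.analyticOnNhd_V hf₁ hφa hfΩ hopen hsum fun α hα => ?_
    refine ControlSystem.analyticAt_V_of_contracting (hf₁ _ ⟨(hss α hα).1, hα⟩) (hφa α hα) ?_
      (hcontr α hα)
    filter_upwards [hD₁.mem_nhds hα] with β hβ using (hss β hβ).2
  have hDA : ∀ α ∈ D₁, ∀ x, x ∈ ControlSystem.DA Ω f α (φ α) ↔
      (x, α) ∈ ControlSystem.G Ω D₁ f φ := fun α hα x => by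
    simp [ControlSystem.mem_G, hα]
  have hDAopen : ∀ α ∈ D₁, IsOpen (ControlSystem.DA Ω f α (φ α)) := fun α hα => by
    have : ControlSystem.DA Ω f α (φ α) = (fun x => (x, α)) ⁻¹' ControlSystem.G Ω D₁ f φ :=
      Set.ext (hDA α hα)
    rw [this]
    exact hopen.preimage (by fun_prop)
  -- Only non-membership is required of `x₀`; frontier points qualify because the domain of
  -- attraction is open.
  have hblow : ∀ α ∈ D₁, ∀ x₀ ∈ Ω, x₀ ∉ ControlSystem.DA Ω f α (φ α) →
      Tendsto (fun x => ControlSystem.V f φ (x, α))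
        (𝓝[ControlSystem.DA Ω f α (φ α)] x₀) atTop := fun α hα x₀ hx₀ hfr =>
    ControlSystem.tendsto_V_frontier hf₁ hfΩ hα (hDAopen α hα) ((hDA α hα _).2 (hpath α hα))
      (fun x hx => hsum (x, α) ((hDA α hα x).1 hx)) hx₀ hfr
  refine ⟨hopen, fun p hp => ?_, hpath, hsum, hV, fun p _ => tsum_nonneg fun _ => sq_nonneg _,
    fun x α hx => ⟨?_, ?_⟩, fun α hα => ?_, fun α hα => ?_, fun α hα x₀ hx₀ => ?_⟩
  · have := ControlSystem.mem_G.1 hp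
    exact ⟨this.2.1, hD₁D this.1⟩
  · have := ControlSystem.mem_G.1 hx
    exact ControlSystem.mem_G.2 ⟨this.1, ControlSystem.iter_mem_DA hfΩ this.1 this.2 1⟩
  · have := ControlSystem.V_eq_sum_add (hsum _ hx) 1
    simp only [Finset.sum_range_one, ControlSystem.iter, Function.iterate_zero, id,
      Function.iterate_one] at this
    linarith
  · have hit : ∀ k, ControlSystem.iter f α k (φ α) = φ α := fun k =>
      Function.iterate_fixed (hss α hα).2 k
    simp [ControlSystem.V, hit]
  · refine ControlSystem.isNaturalDomain_of_tendsto_atTop (hDAopen α hα) (fun x hx => hx.1) ?_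
      (hblow α hα)
    intro x hx
    exact AnalyticAt.comp (g := ControlSystem.V f φ) (f := fun x => (x, α))
      (hV _ ((hDA α hα x).1 hx)) (analyticAt_id.prod analyticAt_const)
  · exact hblow α hα x₀ hx₀.1 fun h => by
      have := hx₀.2.2
      rw [(hDAopen α hα).interior_eq] at this
      exact this h
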